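/- Let $(M,g)$ be an $n$-dimensional smooth Riemannian manifold with Levi-Civita connection $\nabla$, Ricci tensor $\mathrm{Ric}(Y,Z)=\mathrm{tr}(X\mapsto R(X,Y)Z)$, where $R(X,Y)Z=\nabla_X\nabla_YZ-\nabla_Y\nabla_XZ-\nabla_{[X,Y]}Z$, and scalar curvature $\mathrm{scal}=\mathrm{tr}_g\mathrm{Ric}$. Assume that $M$ is a mixed generalized quasi-Einstein manifold, that is, $n\ge 3$, $\mathrm{Ric}$ is not identically zero, and $\mathrm{Ric}=\alpha_0 g+\beta_0 A\otimes A+\gamma_0 B\otimes B+\delta_0(A\otimes B+B\otimes A)$ for some smooth functions $\alpha_0,\beta_0,\gamma_0,\delta_0$ and $1$-forms $A,B$ whose $g$-dual vector fields are orthogonal. Let $V$ be a torqued vector field on $M$, i.e. $\nabla_XV=aX+\psi(X)V$ for all vector fields $X$, where $a$ is a smooth function and $\psi$ is a $1$-form with $\psi(V)=0$. Let $\eta=g(V,\cdot)$ be the $g$-dual $1$-form of $V$, and let $(V,\lambda,\mu)$ be an almost $\eta$-Yamabe soliton, i.e. $\lambda,\mu$ are smooth functions with $$\tfrac12\,\mathcal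 L_Vg=(\mathrm{scal}-\lambda)\,g+\mu\,\eta\otimes\eta .$$ If, for some real-valued functions $\alpha,\beta,\gamma$ on $M$, the Ricci tensor is of the form $$\mathrm{Ric}=\alpha g+\beta\,\eta\otimes\eta+\gamma(\eta\otimes\psi+\psi\otimes\eta),$$ then $$\lambda=\left(\beta+\frac{\mu}{n}\right)|V|^2+\alpha n-a\qquad\text{on } M .$$ -/

import Mathlib

open Bundle FiberBundle VectorField
open scoped Manifold ContDiff

noncomputable section

namespace RiemGeom

/-! Throughout, `M` is a smooth manifold modelled on the finite-dimensional space `E`, and the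
Riemannian metric `g` is Mathlib's: a smoothly varying inner product `inner ℝ` on the tangent
spaces. -/

variable {E : Type*} [NormedAddCommGroup E] [NormedSpace ℝ E]
  {H : Type*} [TopologicalSpace H] (I : ModelWithCorners ℝ E H)
  {M : Type*} [TopologicalSpace M] [ChartedSpace H M] [IsManifold I ∞ M]
  [RiemannianBundle (fun x : M ↦ TangentSpace I x)]

/-! ### The Levi-Civita connection -/

/-- The right-hand side of the Koszul formula for `2 g(∇_X Y, Z)` at the point `x`:
`X g(Y, Z) + Y g(X, Z) - Z g(X, Y) + g([X, Y], Z) - g([X, Z], Y) - g([Y, Z], X)`. -/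
def koszul (X Y Z : Π x : M, TangentSpace I x) (x : M) : ℝ :=
  mvfderiv I (fun y ↦ inner ℝ (Y y) (Z y)) x (X x)
    + mvfderiv I (fun y ↦ inner ℝ (X y) (Z y)) x (Y x)
    - mvfderiv I (fun y ↦ inner ℝ (X y) (Y y)) x (Z x)
    + inner ℝ (mlieBracket I X Y x) (Z x)
    - inner ℝ (mlieBracket I X Z x) (Y x)
    - inner ℝ (mlieBracket I Y Z x) (X x)

variable {I}

theorem mdiffAt_inner [IsContMDiffRiemannianBundle I ∞ E (fun x : M ↦ TangentSpace I x)]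
    {X Y : Π x : M, TangentSpace I x} {x : M}
    (hX : MDiffAt (T% X) x) (hY : MDiffAt (T% Y) x) :
    MDiffAt (fun y ↦ (inner ℝ (X y) (Y y) : ℝ)) x :=
  MDifferentiableAt.inner_bundle (E := fun x : M ↦ TangentSpace I x) (IB := I) (F := E) (b := id)
    hX hY

variable [FiniteDimensional ℝ E]

instance (x : M) : FiniteDimensional ℝ (TangentSpace I x) :=
  inferInstanceAs (FiniteDimensional ℝ E)

instance (x : M) : CompleteSpace (TangentSpace I x) :=
  FiniteDimensional.complete ℝ (TangentSpace I x)

variable [IsContMDiffRiemannianBundle I ∞ E (fun x : M ↦ TangentSpace I x)]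

theorem tensorialAt_koszul_left {Y Z : Π x : M, TangentSpace I x} {x : M}
    (hY : MDiffAt (T% Y) x) (hZ : MDiffAt (T% Z) x) :
    TensorialAt I E (fun X ↦ koszul I X Y Z x) x where
  smul {f X} hf hX := by
    have := FiniteDimensional.complete ℝ E
    simp only [koszul, mlieBracket_smul_left hf hX, inner_smul_left, inner_smul_right,
      inner_add_left, Pi.smul_apply', map_smul, smul_eq_mul, add_apply, smul_apply,
      mvfderiv_fun_mul hf (mdiffAt_inner hX hZ), mvfderiv_fun_mul hf (mdiffAt_inner hX hY),
      conj_trivial]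
    simp
    ring
  add {X X'} hX hX' := by
    have := FiniteDimensional.complete ℝ E
    simp [koszul, mlieBracket_add_left hX hX', inner_add_left, inner_add_right,
      mvfderiv_fun_add (mdiffAt_inner hX hZ) (mdiffAt_inner hX' hZ),
      mvfderiv_fun_add (mdiffAt_inner hX hY) (mdiffAt_inner hX' hY)]
    ring

theorem tensorialAt_koszul_right {X Y : Π x : M, TangentSpace I x} {x : M}
    (hX : MDiffAt (T% X) x) (hY : MDiffAt (T% Y) x) :
    TensorialAt I E (fun Z ↦ koszul I X Y Z x) x where
  smul {f Z} hf hZ := by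
    have := FiniteDimensional.complete ℝ E
    simp [koszul, mlieBracket_smul_right hf hZ, inner_smul_left, inner_smul_right,
      inner_add_left,
      mvfderiv_fun_mul hf (mdiffAt_inner hX hZ), mvfderiv_fun_mul hf (mdiffAt_inner hY hZ)]
    rw [real_inner_comm (Z x) (X x), real_inner_comm (Z x) (Y x)]
    ring
  add {Z Z'} hZ hZ' := by
    have := FiniteDimensional.complete ℝ E
    simp [koszul, mlieBracket_add_right hZ hZ', inner_add_left, inner_add_right,
      mvfderiv_fun_add (mdiffAt_inner hX hZ) (mdiffAt_inner hX hZ'),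
      mvfderiv_fun_add (mdiffAt_inner hY hZ) (mdiffAt_inner hY hZ')]
    ring

open Classical in
/-- The map `Y ↦ ∇ Y` determined by the Koszul formula; `∇ Y` is set to `0` at the points where
`Y` is not differentiable. -/
def leviCivitaFun (Y : Π x : M, TangentSpace I x) (x : M) :
    TangentSpace I x →L[ℝ] TangentSpace I x :=
  if hY : MDiffAt (T% Y) x then
    (1 / 2 : ℝ) • ((InnerProductSpace.toDual ℝ
        (TangentSpace I x)).symm.toContinuousLinearEquiv.toContinuousLinearMap ∘L
      (TensorialAt.mkHom₂ (fun X Z ↦ koszul I X Y Z x) x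
        (fun _ hZ ↦ tensorialAt_koszul_left hY hZ) (fun _ hX ↦ tensorialAt_koszul_right hX hY)))
  else 0

/-- The Koszul formula. -/
theorem inner_leviCivitaFun {X Y Z : Π x : M, TangentSpace I x} {x : M}
    (hX : MDiffAt (T% X) x) (hY : MDiffAt (T% Y) x) (hZ : MDiffAt (T% Z) x) :
    inner ℝ (leviCivitaFun Y x (X x)) (Z x) = 1 / 2 * koszul I X Y Z x := by
  rw [← TensorialAt.mkHom₂_apply (Φ := fun X Z ↦ koszul I X Y Z x)
    (fun _ hZ ↦ tensorialAt_koszul_left hY hZ) (fun _ hX ↦ tensorialAt_koszul_right hX hY) hX hZ]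
  simp [leviCivitaFun, hY, inner_smul_left]

theorem leviCivitaFun_ext {Y : Π x : M, TangentSpace I x} {x : M} (hY : MDiffAt (T% Y) x)
    (L : TangentSpace I x →L[ℝ] TangentSpace I x)
    (h : ∀ X Z : Π x : M, TangentSpace I x, MDiffAt (T% X) x → MDiffAt (T% Z) x →
      koszul I X Y Z x = 2 * inner ℝ (L (X x)) (Z x)) :
    leviCivitaFun Y x = L := by
  ext1 v
  refine ext_inner_right ℝ fun w ↦ ?_
  have hv := mdifferentiableAt_extend I E v
  have hw := mdifferentiableAt_extend I E w
  have h1 := inner_leviCivitaFun hv hY hw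
  rw [h _ _ hv hw] at h1
  simpa using h1

variable (I M) in
/-- The Levi-Civita connection of the Riemannian metric of `M`; `∇_X Y` at `x` is written
`leviCivita I M Y x (X x)`. It is torsion-free and metric by the two theorems below. -/
def leviCivita : CovariantDerivative I E (fun x : M ↦ TangentSpace I x) where
  toFun := leviCivitaFun
  isCovariantDerivativeOnUniv :=
    { add := by
        intro Y Y' x hY hY' _
        have := FiniteDimensional.complete ℝ E
        refine leviCivitaFun_ext (mdifferentiableAt_add_section hY hY') _ fun X Z hX hZ ↦ ?_
        have h1 := inner_leviCivitaFun hX hY hZ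
        have h2 := inner_leviCivitaFun hX hY' hZ
        simp only [add_apply, inner_add_left, h1, h2]
        simp [koszul, mlieBracket_add_left hY hY', mlieBracket_add_right hY hY',
          inner_add_left, inner_add_right,
          mvfderiv_fun_add (mdiffAt_inner hY hZ) (mdiffAt_inner hY' hZ),
          mvfderiv_fun_add (mdiffAt_inner hX hY) (mdiffAt_inner hX hY')]
        ring
      leibniz := by
        intro Y f x hY hf _
        have := FiniteDimensional.complete ℝ E
        refine leviCivitaFun_ext (hf.smul_section hY) _ fun X Z hX hZ ↦ ?_
        have h1 := inner_leviCivitaFun hX hY hZ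
        simp only [add_apply, smul_apply,
          ContinuousLinearMap.smulRight_apply, inner_add_left, inner_smul_left, h1]
        simp [koszul, mlieBracket_smul_left hf hY, mlieBracket_smul_right hf hY,
          inner_add_left, inner_smul_left, inner_smul_right,
          mvfderiv_fun_mul hf (mdiffAt_inner hY hZ), mvfderiv_fun_mul hf (mdiffAt_inner hX hY)]
        rw [real_inner_comm (Y x) (X x)]
        ring }

theorem inner_leviCivita {X Y Z : Π x : M, TangentSpace I x} {x : M}
    (hX : MDiffAt (T% X) x) (hY : MDiffAt (T% Y) x) (hZ : MDiffAt (T% Z) x) :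
    inner ℝ (leviCivita I M Y x (X x)) (Z x) = 1 / 2 * koszul I X Y Z x :=
  inner_leviCivitaFun hX hY hZ

theorem leviCivita_metric {X Y Z : Π x : M, TangentSpace I x} {x : M}
    (hX : MDiffAt (T% X) x) (hY : MDiffAt (T% Y) x) (hZ : MDiffAt (T% Z) x) :
    mvfderiv I (fun y ↦ inner ℝ (Y y) (Z y)) x (X x) =
      inner ℝ (leviCivita I M Y x (X x)) (Z x) + inner ℝ (Y x) (leviCivita I M Z x (X x)) := by
  rw [real_inner_comm _ (Y x), inner_leviCivita hX hY hZ, inner_leviCivita hX hZ hY]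
  simp only [koszul, real_inner_comm (Z _) (Y _),
    mlieBracket_swap_apply (I := I) (V := Z) (W := Y), inner_neg_left]
  ring

theorem leviCivita_torsion_free {X Y : Π x : M, TangentSpace I x} {x : M}
    (hX : MDiffAt (T% X) x) (hY : MDiffAt (T% Y) x) :
    leviCivita I M Y x (X x) - leviCivita I M X x (Y x) = mlieBracket I X Y x := by
  refine ext_inner_right ℝ fun w ↦ ?_
  have hw := mdifferentiableAt_extend I E w
  have h1 := inner_leviCivita hX hY hw
  have h2 := inner_leviCivita hY hX hw
  simp only [extend_apply_self] at h1 h2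
  rw [inner_sub_left, h1, h2]
  simp only [koszul, real_inner_comm (Y _) (X _), extend_apply_self,
    mlieBracket_swap_apply (I := I) (V := Y) (W := X), inner_neg_left]
  ring

/-! ### Curvature -/

variable (I) in
/-- The Riemann curvature `R(X, Y) Z = ∇_X ∇_Y Z - ∇_Y ∇_X Z - ∇_[X, Y] Z` at the point `x`. -/
def curvature (X Y Z : Π x : M, TangentSpace I x) (x : M) : TangentSpace I x :=
  leviCivita I M (fun y ↦ leviCivita I M Z y (Y y)) x (X x)
    - leviCivita I M (fun y ↦ leviCivita I M Z y (X y)) x (Y x)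
    - leviCivita I M Z x (mlieBracket I X Y x)

variable (I) in
/-- The Ricci tensor `Ric(v, w) = tr (u ↦ R(u, v) w)`, computed in an orthonormal basis of the
tangent space at `x`. The curvature at `x` only depends on the values at `x` of its arguments,
so that they may be any smooth local extensions. -/
def ricci (x : M) (v w : TangentSpace I x) : ℝ :=
  ∑ i, inner ℝ
    (curvature I (extend E (stdOrthonormalBasis ℝ (TangentSpace I x) i)) (extend E v) (extend E w) x)
    (stdOrthonormalBasis ℝ (TangentSpace I x) i)

variable (I) in
/-- The scalar curvature: the trace of the Ricci tensor with respect to the metric. -/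
def scal (x : M) : ℝ :=
  ∑ i, ricci I x (stdOrthonormalBasis ℝ (TangentSpace I x) i)
    (stdOrthonormalBasis ℝ (TangentSpace I x) i)

end RiemGeom

namespace RiemGeom

variable {E : Type*} [NormedAddCommGroup E] [NormedSpace ℝ E]
  {H : Type*} [TopologicalSpace H] {I : ModelWithCorners ℝ E H}
  {M : Type*} [TopologicalSpace M] [ChartedSpace H M] [IsManifold I ∞ M]

/-! ### Vector fields, one-forms and the Lie derivative of the metric -/

/-- Smoothness of a vector field. -/
def IsSmoothVectorField (V : Π x : M, TangentSpace I x) : Prop :=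
  ContMDiff I I.tangent ∞ (fun x ↦ TotalSpace.mk' E x (V x))

/-- Smoothness of a one-form. -/
def IsSmoothOneForm (A : Π x : M, TangentSpace I x →L[ℝ] ℝ) : Prop :=
  ContMDiff I (I.prod 𝓘(ℝ, E →L[ℝ] ℝ)) ∞ (fun x ↦ TotalSpace.mk' (E →L[ℝ] ℝ) x (A x))

variable [RiemannianBundle (fun x : M ↦ TangentSpace I x)]

/-- `η` is the `g`-dual one-form of the vector field `V`: `η(X) = g(V, X)`. -/
def IsMetricDual (η : Π x : M, TangentSpace I x →L[ℝ] ℝ) (V : Π x : M, TangentSpace I x) : Prop :=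
  ∀ (x : M) (v : TangentSpace I x), η x v = inner ℝ (V x) v

variable (I) in
/-- The Lie derivative of the metric at the point `x`:
`(£_V g)(X, Y) = V g(X, Y) - g([V, X], Y) - g(X, [V, Y])`. -/
def lieDerivMetric (V X Y : Π x : M, TangentSpace I x) (x : M) : ℝ :=
  mvfderiv I (fun y ↦ inner ℝ (X y) (Y y)) x (V x)
    - inner ℝ (mlieBracket I V X x) (Y x) - inner ℝ (X x) (mlieBracket I V Y x)

variable [FiniteDimensional ℝ E] [IsContMDiffRiemannianBundle I ∞ E (fun x : M ↦ TangentSpace I x)]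

/-- `V` is a torse-forming vector field, with function `a` and one-form `ψ`:
`∇_X V = a X + ψ(X) V`. -/
structure IsTorseForming (V : Π x : M, TangentSpace I x) (a : M → ℝ)
    (ψ : Π x : M, TangentSpace I x →L[ℝ] ℝ) : Prop where
  smooth : IsSmoothVectorField V
  smooth_fun : ContMDiff I 𝓘(ℝ) ∞ a
  smooth_form : IsSmoothOneForm ψ
  eq : ∀ (x : M) (v : TangentSpace I x), leviCivita I M V x v = a x • v + ψ x v • V x

/-- A torqued vector field is a torse-forming one with `ψ(V) = 0`. -/
structure IsTorqued (V : Π x : M, TangentSpace I x) (a : M → ℝ)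
    (ψ : Π x : M, TangentSpace I x →L[ℝ] ℝ) : Prop extends IsTorseForming V a ψ where
  form_apply : ∀ x : M, ψ x (V x) = 0

/-- `(V, lam, μ)` is an almost `η`-Yamabe soliton:
`(1/2) £_V g = (scal - lam) g + μ η ⊗ η`, with `lam` and `μ` smooth functions. -/
structure IsAlmostEtaYamabeSoliton (V : Π x : M, TangentSpace I x)
    (η : Π x : M, TangentSpace I x →L[ℝ] ℝ) (lam μ : M → ℝ) : Prop where
  smooth : IsSmoothVectorField V
  smooth_form : IsSmoothOneForm η
  smooth_lam : ContMDiff I 𝓘(ℝ) ∞ lam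
  smooth_mu : ContMDiff I 𝓘(ℝ) ∞ μ
  eq : ∀ (x : M) (X Y : Π x : M, TangentSpace I x),
    ContMDiffAt I I.tangent ∞ (fun y ↦ TotalSpace.mk' E y (X y)) x →
    ContMDiffAt I I.tangent ∞ (fun y ↦ TotalSpace.mk' E y (Y y)) x →
    1 / 2 * lieDerivMetric I V X Y x =
      (scal I x - lam x) * inner ℝ (X x) (Y x) + μ x * (η x (X x) * η x (Y x))

variable (I M) in
/-- `M` is a mixed generalized quasi-Einstein manifold: `dim M ≥ 3`, the Ricci tensor is not
identically zero (so that `M` is not flat), and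
`Ric = α g + β A ⊗ A + γ B ⊗ B + δ (A ⊗ B + B ⊗ A)` for smooth functions `α, β, γ, δ` and one-forms
`A, B` that are the `g`-duals of two orthogonal vector fields `U, W`. -/
def IsMixedGeneralizedQuasiEinstein : Prop :=
  3 ≤ Module.finrank ℝ E ∧
  (∃ (x : M) (v w : TangentSpace I x), ricci I x v w ≠ 0) ∧
  ∃ (α β γ δ : M → ℝ) (A B : Π x : M, TangentSpace I x →L[ℝ] ℝ) (U W : Π x : M, TangentSpace I x),
    ContMDiff I 𝓘(ℝ) ∞ α ∧ ContMDiff I 𝓘(ℝ) ∞ β ∧ ContMDiff I 𝓘(ℝ) ∞ γ ∧ ContMDiff I 𝓘(ℝ) ∞ δ ∧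
    IsSmoothOneForm A ∧ IsSmoothOneForm B ∧ IsMetricDual A U ∧ IsMetricDual B W ∧
    (∀ x : M, inner ℝ (U x) (W x) = 0) ∧
    ∀ (x : M) (v w : TangentSpace I x), ricci I x v w =
      α x * inner ℝ v w + β x * (A x v * A x w) + γ x * (B x v * B x w)
        + δ x * (A x v * B x w + B x v * A x w)

end RiemGeom

end

namespace RiemGeom

variable {E : Type*} [NormedAddCommGroup E] [NormedSpace ℝ E] [FiniteDimensional ℝ E]
  {H : Type*} [TopologicalSpace H] {I : ModelWithCorners ℝ E H}
  {M : Type*} [TopologicalSpace M] [ChartedSpace H M] [IsManifold I ∞ M]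
  [RiemannianBundle (fun x : M ↦ TangentSpace I x)]
  [IsContMDiffRiemannianBundle I ∞ E (fun x : M ↦ TangentSpace I x)]

/-! The proof compares two traces. Since half of `£_V g` is the symmetrization of `∇V`, the torqued
equation turns the soliton equation into `a g + (1/2)(ψ ⊗ η + η ⊗ ψ) = (scal - λ) g + μ η ⊗ η`. The
trace of `ψ ⊗ η` is `ψ(V) = 0` and that of `η ⊗ η` is `|V|²`, so tracing gives `n a = n (scal - λ) +
μ |V|²`. For the same reason the `γ` term drops out of the trace of the assumed form of `Ric`,
leaving `scal = n α + β |V|²`. Eliminating `scal` and dividing by `n` gives `λ`. -/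

/-- The Lie derivative of the metric is the symmetrization of the covariant derivative:
`(£_V g)(X, Y) = g(∇_X V, Y) + g(X, ∇_Y V)`. -/
theorem lieDerivMetric_eq {V X Y : Π x : M, TangentSpace I x} {x : M}
    (hV : MDiffAt (T% V) x) (hX : MDiffAt (T% X) x) (hY : MDiffAt (T% Y) x) :
    lieDerivMetric I V X Y x =
      inner ℝ (leviCivita I M V x (X x)) (Y x) + inner ℝ (X x) (leviCivita I M V x (Y x)) := by
  -- Metric compatibility expands `V g(X, Y)`, and vanishing torsion gives `[V, X] = ∇_V X - ∇_X V`;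
  -- the `∇_V` terms then cancel.
  rw [lieDerivMetric, leviCivita_metric hV hX hY, ← leviCivita_torsion_free hV hX,
    ← leviCivita_torsion_free hV hY, inner_sub_left, inner_sub_right]
  ring

/-- The trace of `v ↦ φ(v) g(V, v)` in an orthonormal basis is `φ(V)`. -/
theorem sum_apply_mul_inner {F ι : Type*} [Fintype ι] [NormedAddCommGroup F]
    [InnerProductSpace ℝ F] (b : OrthonormalBasis ι ℝ F) (φ : F →L[ℝ] ℝ) (V : F) :
    ∑ i, φ (b i) * inner ℝ V (b i) = φ V := by
  -- Expand `V` in the basis and use linearity of `φ`.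
  conv_rhs => rw [← b.sum_repr' V]
  simp [map_sum, mul_comm, real_inner_comm]

/-- The scalar curvature when `Ric = α g + β η ⊗ η + γ (η ⊗ ψ + ψ ⊗ η)` at the point `x`, where
`η` is dual to a vector in the kernel of `ψ`. -/
theorem scal_eq_of_ricci_eq {x : M} {V : TangentSpace I x} {η ψ : TangentSpace I x →L[ℝ] ℝ}
    {α β γ : ℝ} (hη : ∀ v, η v = inner ℝ V v) (hψ : ψ V = 0)
    (hRic : ∀ v w : TangentSpace I x, ricci I x v w =
      α * inner ℝ v w + β * (η v * η w) + γ * (η v * ψ w + ψ v * η w)) :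
    scal I x = α * Module.finrank ℝ (TangentSpace I x) + β * ‖V‖ ^ 2 := by
  set b := stdOrthonormalBasis ℝ (TangentSpace I x)
  -- Both traces come from `sum_apply_mul_inner`, with `φ = η` giving `η(V) = |V|²` and `φ = ψ`
  -- giving `ψ(V) = 0`.
  have h1 : ∑ i, η (b i) * η (b i) = ‖V‖ ^ 2 := by
    rw [← real_inner_self_eq_norm_sq, ← hη, ← sum_apply_mul_inner b η V]
    simp only [hη]
  have h2 : ∑ i, ψ (b i) * η (b i) = 0 := by
    rw [← hψ, ← sum_apply_mul_inner b ψ V]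
    simp only [hη]
  -- On the diagonal the two mixed terms coincide, hence the factor `2 * γ`.
  calc scal I x = ∑ i, (α + β * (η (b i) * η (b i)) + 2 * γ * (ψ (b i) * η (b i))) := by
        refine Finset.sum_congr rfl fun i _ ↦ ?_
        rw [hRic, real_inner_self_eq_norm_sq, b.norm_eq_one]
        ring
    _ = _ := by
        simp only [Finset.sum_add_distrib, ← Finset.mul_sum, h1, h2]
        simp [mul_comm]

/-- The trace of the soliton equation of an almost `η`-Yamabe soliton with torqued potential. -/
theorem IsAlmostEtaYamabeSoliton.trace_eq_of_isTorqued {V : Π x : M, TangentSpace I x}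
    {η ψ : Π x : M, TangentSpace I x →L[ℝ] ℝ} {a lam μ : M → ℝ}
    (hsol : IsAlmostEtaYamabeSoliton V η lam μ) (hV : IsTorqued V a ψ) (hη : IsMetricDual η V)
    (x : M) :
    a x * Module.finrank ℝ (TangentSpace I x) =
      (scal I x - lam x) * Module.finrank ℝ (TangentSpace I x) + μ x * ‖V x‖ ^ 2 := by
  set b := stdOrthonormalBasis ℝ (TangentSpace I x)
  have h1 : ∑ i, η x (b i) * η x (b i) = ‖V x‖ ^ 2 := by
    rw [← real_inner_self_eq_norm_sq, ← hη, ← sum_apply_mul_inner b (η x) (V x)]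
    simp only [hη x]
  have hVx : MDiffAt (T% V) x := (hV.smooth x).mdifferentiableAt (by simp)
  -- The soliton equation on the pair `(b i, b i)`, extended to local smooth fields. The two halves
  -- of the symmetrized `∇V` agree there, which absorbs the factor `1 / 2`.
  have key (i) : a x + ψ x (b i) * inner ℝ (V x) (b i) =
      (scal I x - lam x) + μ x * (η x (b i) * η x (b i)) := by
    have h := hsol.eq x (extend E (b i)) (extend E (b i)) (contMDiffAt_extend I E (b i))
      (contMDiffAt_extend I E (b i))
    rw [lieDerivMetric_eq hVx (mdifferentiableAt_extend I E (b i))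
      (mdifferentiableAt_extend I E (b i))] at h
    simp only [extend_apply_self, hV.eq, inner_add_left, inner_add_right, inner_smul_left,
      inner_smul_right, real_inner_self_eq_norm_sq, b.norm_eq_one, conj_trivial,
      real_inner_comm (V x) (b i)] at h
    linarith
  have hsum := Finset.sum_congr (rfl : Finset.univ = Finset.univ) fun i _ ↦ key i
  -- Summing over `i`, the `ψ` term becomes `ψ(V)`, which vanishes because `V` is torqued.
  simp only [Finset.sum_add_distrib, ← Finset.mul_sum, h1, sum_apply_mul_inner b (ψ x) (V x),
    hV.form_apply] at hsum
  simpa [mul_comm (Module.finrank ℝ _ : ℝ), sub_mul] using hsum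

end RiemGeom

theorem mainTheorem11 {n : ℕ} {M : Type*} [TopologicalSpace M] [T2Space M]
    [SecondCountableTopology M] [ChartedSpace (EuclideanSpace ℝ (Fin n)) M]
    [IsManifold (𝓡 n) ∞ M]
    [RiemannianBundle (fun x : M ↦ TangentSpace (𝓡 n) x)]
    [IsContMDiffRiemannianBundle (𝓡 n) ∞ (EuclideanSpace ℝ (Fin n))
      (fun x : M ↦ TangentSpace (𝓡 n) x)]
    (hM : RiemGeom.IsMixedGeneralizedQuasiEinstein (𝓡 n) M)
    (V : Π x : M, TangentSpace (𝓡 n) x)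
    (η ψ : Π x : M, TangentSpace (𝓡 n) x →L[ℝ] ℝ)
    (a lam μ α β γ : M → ℝ)
    (hV : RiemGeom.IsTorqued V a ψ)
    (hη : RiemGeom.IsMetricDual η V)
    (hsol : RiemGeom.IsAlmostEtaYamabeSoliton V η lam μ)
    (hRic : ∀ (x : M) (v w : TangentSpace (𝓡 n) x), RiemGeom.ricci (𝓡 n) x v w =
      α x * inner ℝ v w + β x * (η x v * η x w) + γ x * (η x v * ψ x w + ψ x v * η x w))
    (x : M) :
    lam x = (β x + μ x / n) * ‖V x‖ ^ 2 + α x * n - a x := by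
  have hfin : Module.finrank ℝ (TangentSpace (𝓡 n) x) = n := finrank_euclideanSpace_fin
  -- The bound `3 ≤ n` is what allows the traced equation to be divided by `n`.
  have hn : (n : ℝ) ≠ 0 := by
    have h3 : 3 ≤ n := finrank_euclideanSpace_fin (𝕜 := ℝ) (n := n) ▸ hM.1
    exact_mod_cast (by omega : n ≠ 0)
  have htrace := hsol.trace_eq_of_isTorqued hV hη x
  rw [RiemGeom.scal_eq_of_ricci_eq (hη x) (hV.form_apply x) (hRic x), hfin] at htrace
  field_simp
  linarith
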